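/- Let $(X,\phi)$ be a Cantor minimal system, that is, $X$ is a Cantor set (a nonempty compact metrizable totally disconnected space without isolated points) and $\phi:X\to X$ is a homeomorphism such that for every $x\in X$ the orbit $\{\phi^n(x)\mid n\in\mathbb{Z}\}$ is dense in $X$. Let $[[\phi]]$ be its topological full group, that is, the group of all homeomorphisms $\psi:X\to X$ for which there is a continuous map $c:X\to\mathbb{Z}$ with $\psi(x)=\phi^{c(x)}(x)$ for all $x\in X$, and let $D([[\phi]])$ be the commutator subgroup of $[[\phi]]$. If $D([[\phi]])$ is finitely generated, then it has exponential growth: for every finite generating set $S$ of $D([[\phi]])$ there is a real number $c>1$ such that for every $n\ge 0$ at least $c^n$ elements of $D([[\phi]])$ are products of at most $n$ elements of $S\cup S^{-1}$. -/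

import Mathlib

/-- A homeomorphism `φ` of `X` is minimal if every two-sided orbit `{φ ^ n x | n ∈ ℤ}` is dense. -/
def IsMinimalHomeo {X : Type*} [TopologicalSpace X] (φ : X ≃ₜ X) : Prop :=
  ∀ x : X, Dense (Set.range fun n : ℤ => (φ ^ n) x)

/-- The class of Cantor sets: nonempty compact metrizable totally disconnected spaces
without isolated points. -/
class IsCantorSpace (X : Type*) [TopologicalSpace X] : Prop where
  nonempty : Nonempty X
  compact : CompactSpace X
  metrizable : TopologicalSpace.MetrizableSpace X
  totallyDisconnected : TotallyDisconnectedSpace X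
  perfect : PerfectSpace X

/-- `(X, φ)` is a Cantor minimal system. -/
structure IsCantorMinimalSystem (X : Type*) [TopologicalSpace X] (φ : X ≃ₜ X) : Prop where
  cantor : IsCantorSpace X
  minimal : IsMinimalHomeo φ

/-- The topological full group `[[φ]]`: all homeomorphisms `ψ` of `X` for which there is a
continuous `c : X → ℤ` (with `ℤ` discrete) such that `ψ x = φ ^ (c x) x` for all `x`. -/
def topologicalFullGroup {X : Type*} [TopologicalSpace X] (φ : X ≃ₜ X) : Subgroup (X ≃ₜ X) where
  carrier := {ψ | ∃ c : X → ℤ, Continuous c ∧ ∀ x, ψ x = (φ ^ c x) x}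
  one_mem' := ⟨fun _ => 0, continuous_const, fun x => by simp⟩
  mul_mem' := by
    rintro ψ₁ ψ₂ ⟨c₁, hc₁, h₁⟩ ⟨c₂, hc₂, h₂⟩
    refine ⟨fun x => c₁ (ψ₂ x) + c₂ x, (hc₁.comp ψ₂.continuous).add hc₂, fun x => ?_⟩
    rw [Homeomorph.mul_apply, h₁, zpow_add, Homeomorph.mul_apply, ← h₂]
  inv_mem' := by
    rintro ψ ⟨c, hc, h⟩
    refine ⟨fun x => -c (ψ⁻¹ x), (hc.comp (ψ⁻¹).continuous).neg, fun x => ?_⟩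
    have h1 : ψ (ψ⁻¹ x) = x := by rw [← Homeomorph.mul_apply, mul_inv_cancel]; rfl
    have h2 := h (ψ⁻¹ x)
    rw [h1] at h2
    have h3 : (φ ^ (-c (ψ⁻¹ x))) ((φ ^ c (ψ⁻¹ x)) (ψ⁻¹ x)) = ψ⁻¹ x := by
      rw [← Homeomorph.mul_apply, ← zpow_add, neg_add_cancel, zpow_zero]; rfl
    rw [← h2] at h3
    exact h3.symm

/-- The ball of radius `n` around `1` for the word length of `S`: the elements that are products
of at most `n` factors, each in `S` or inverse to an element of `S`. -/
def wordBall {G : Type*} [Group G] (S : Set G) (n : ℕ) : Set G :=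
  {g | ∃ l : List G, l.length ≤ n ∧ (∀ x ∈ l, x ∈ S ∨ x⁻¹ ∈ S) ∧ l.prod = g}

/-- The balls for a finite set are finite, so that `Set.ncard` is their true cardinality. -/
theorem wordBall_finite {G : Type*} [Group G] {S : Set G} (hS : S.Finite) (n : ℕ) :
    (wordBall S n).Finite := by
  have hT : (S ∪ S⁻¹).Finite := hS.union hS.inv
  have := hT.to_subtype
  refine ((List.finite_length_le (↥(S ∪ S⁻¹)) n).image
    (fun l => (l.map Subtype.val).prod)).subset ?_
  rintro g ⟨l, hl, hS', rfl⟩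
  refine ⟨l.attach.map (fun x => ⟨x.1, hS' x.1 x.2⟩), by simpa using hl, ?_⟩
  simp [List.map_map, Function.comp_def]

/-- The growth function `n ↦ |B_S(n)|` of `G` with respect to `S`. -/
noncomputable def growthFunction {G : Type*} [Group G] (S : Set G) (n : ℕ) : ℕ :=
  (wordBall S n).ncard

/-- A group has exponential growth if it is finitely generated and, for every finite generating
set `S`, there is `c > 1` with `|B_S(n)| ≥ c ^ n` for all `n`. -/
def HasExponentialGrowth (G : Type*) [Group G] : Prop :=
  Group.FG G ∧ ∀ S : Set G, S.Finite → Subgroup.closure S = ⊤ →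
    ∃ c : ℝ, 1 < c ∧ ∀ n : ℕ, c ^ n ≤ (growthFunction S n : ℝ)

/-! The commutator subgroup D contains a free semigroup on two generators, found inside a
lamplighter-type action. Take a clopen B disjoint from its translates by φ, φ², φ³, with first
return map T. Some t in D acts as T on B and as its copy on φB. If A ⊆ B is clopen, exchanging A
with φA adds the indicator f of A to the ℤ/2-coordinate of B ⊔ φB, and its commutator s with t⁻¹
lies in D and adds f + f∘T. A positive word in ts and t then adds p(T)(f + f∘T), where p has the
letters of the word as coefficients (`prod_words_apply`). If two words of equal length agree, a
nonzero polynomial in T kills f, so f is T-periodic (`exists_period_of_aeval_eq_zero`).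

Finite generation supplies an A that is not T-periodic (`exists_nonperiodic_of_fg`). Otherwise the
cocycles of the generators would have a common period m, so all of D would displace x and Tᵐx alike;
but a commutator of two local swaps moves x and fixes Tᵐx. -/

/-! ### Polynomials over 𝔽₂ -/

open Polynomial in
/-- A function killed by a nonzero polynomial over `𝔽₂` in a permutation is periodic. -/
theorem exists_period_of_aeval_eq_zero {Y : Type*} (T : Equiv.Perm Y) (h : Y → ZMod 2)
    {p : (ZMod 2)[X]} (hp : p ≠ 0)
    (hker : (aeval (LinearMap.funLeft (ZMod 2) (ZMod 2) T) p) h = 0) :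
    ∃ m : ℕ, 0 < m ∧ ∀ y, h ((T ^ m) y) = h y := by
  -- The quotient 𝔽₂[X]/(p) is finite, so two powers of X coincide in it and p divides some X^b -
  -- X^a.
  have : Module.Finite (ZMod 2) (AdjoinRoot p) := (AdjoinRoot.powerBasis hp).finite
  have : Finite (AdjoinRoot p) := Module.finite_of_finite (ZMod 2)
  obtain ⟨a, b, hab, heq⟩ :=
    Finite.exists_ne_map_eq_of_infinite (fun k : ℕ => (AdjoinRoot.root p) ^ k)
  wlog hlt : a < b generalizing a b
  · exact this b a hab.symm heq.symm (by omega)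
  have hdvd : p ∣ X ^ b - X ^ a := by
    rw [← AdjoinRoot.mk_eq_zero]
    simpa [sub_eq_zero] using heq.symm
  obtain ⟨q, hq⟩ := hdvd
  have hpow : ∀ k : ℕ, ∀ y, ((LinearMap.funLeft (ZMod 2) (ZMod 2) T) ^ k) h y = h ((T ^ k) y) := by
    intro k
    induction k with
    | zero => simp
    | succ k ih => intro y; rw [pow_succ', Module.End.mul_apply, LinearMap.funLeft_apply, ih,
        pow_succ, Equiv.Perm.mul_apply]
  have h0 : (aeval (LinearMap.funLeft (ZMod 2) (ZMod 2) T) (X ^ b - X ^ a : (ZMod 2)[X])) h = 0 := by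
    rw [hq, mul_comm, map_mul, Module.End.mul_apply, hker, map_zero]
  refine ⟨b - a, by omega, fun y => ?_⟩
  -- Invertibility of T strips the common factor X^a.
  have h1 := congrFun h0 ((T ^ a)⁻¹ y)
  simp only [map_sub, map_pow, aeval_X, LinearMap.sub_apply, Pi.sub_apply, hpow,
    Pi.zero_apply, sub_eq_zero] at h1
  rw [← Equiv.Perm.mul_apply, ← Equiv.Perm.mul_apply, mul_inv_cancel, Equiv.Perm.one_apply] at h1
  rw [← h1, pow_sub _ hlt.le]

open Polynomial in
/-- The polynomial over `𝔽₂` whose coefficients are the entries of a list of bits, the head of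
the list being the leading coefficient. -/
noncomputable def bitPolynomial : List Bool → (ZMod 2)[X]
  | [] => 0
  | b :: l => (if b then X ^ l.length else 0) + bitPolynomial l

theorem coeff_bitPolynomial_of_length_le (l : List Bool) :
    ∀ k, l.length ≤ k → (bitPolynomial l).coeff k = 0 := by
  induction l with
  | nil => simp [bitPolynomial]
  | cons b l ih =>
    intro k hk
    rw [List.length_cons] at hk
    rw [bitPolynomial, Polynomial.coeff_add, ih k (by omega)]
    cases b <;> simp [Polynomial.coeff_X_pow]
    omega

/-- Only the head contributes in degree `l.length`, so it can be read off and cancelled. -/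
theorem bitPolynomial_injective_of_length_eq :
    ∀ l l' : List Bool, l.length = l'.length → bitPolynomial l = bitPolynomial l' → l = l' := by
  intro l
  induction l with
  | nil => intro l' h _; exact (List.length_eq_zero_iff.1 h.symm).symm
  | cons b l ih =>
    intro l' hl h
    cases l' with
    | nil => simp at hl
    | cons b' l' =>
      have hl' : l.length = l'.length := by simpa using hl
      have hb : b = b' := by
        have := congrArg (fun p => p.coeff l.length) h
        simp only [bitPolynomial, Polynomial.coeff_add,
          coeff_bitPolynomial_of_length_le l _ le_rfl,
          coeff_bitPolynomial_of_length_le l' _ hl'.ge, ← hl'] at this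
        revert this
        cases b <;> cases b' <;> simp
      subst hb
      rw [bitPolynomial, bitPolynomial, hl'] at h
      rw [ih l' hl' (add_left_cancel h)]

/-! ### Growth from a free semigroup -/

section WordBall

variable {G : Type*} [Group G] {S : Set G}

theorem wordBall_mono {m n : ℕ} (h : m ≤ n) : wordBall S m ⊆ wordBall S n := by
  rintro g ⟨l, hl, hS, hg⟩
  exact ⟨l, hl.trans h, hS, hg⟩

theorem one_mem_wordBall (n : ℕ) : (1 : G) ∈ wordBall S n := ⟨[], by simp⟩

theorem mul_mem_wordBall {m n : ℕ} {g h : G} (hg : g ∈ wordBall S m) (hh : h ∈ wordBall S n) :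
    g * h ∈ wordBall S (m + n) := by
  obtain ⟨l, hl, hS, rfl⟩ := hg
  obtain ⟨l', hl', hS', rfl⟩ := hh
  refine ⟨l ++ l', by simp; omega, fun x hx => ?_, by simp⟩
  rcases List.mem_append.1 hx with h | h
  exacts [hS x h, hS' x h]

theorem inv_mem_wordBall {n : ℕ} {g : G} (hg : g ∈ wordBall S n) : g⁻¹ ∈ wordBall S n := by
  obtain ⟨l, hl, hS, rfl⟩ := hg
  refine ⟨(l.map (·⁻¹)).reverse, by simpa using hl, fun x hx => ?_, by
    rw [List.prod_inv_reverse]⟩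
  simp only [List.mem_reverse, List.mem_map] at hx
  obtain ⟨y, hy, rfl⟩ := hx
  simpa [or_comm] using hS y hy

theorem exists_mem_wordBall (hS : Subgroup.closure S = ⊤) (g : G) : ∃ n, g ∈ wordBall S n := by
  have hg : g ∈ Subgroup.closure S := hS ▸ Subgroup.mem_top g
  induction hg using Subgroup.closure_induction with
  | mem x hx => exact ⟨1, [x], by simp [hx]⟩
  | one => exact ⟨0, one_mem_wordBall 0⟩
  | mul x y _ _ hx hy =>
    obtain ⟨m, hm⟩ := hx
    obtain ⟨n, hn⟩ := hy
    exact ⟨m + n, mul_mem_wordBall hm hn⟩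
  | inv x _ hx =>
    obtain ⟨m, hm⟩ := hx
    exact ⟨m, inv_mem_wordBall hm⟩

/-- A finitely generated group containing two elements whose positive words of equal length are
pairwise distinct has exponential growth. -/
theorem hasExponentialGrowth_of_words (hG : Group.FG G) (w : Bool → G)
    (hw : ∀ l l' : List Bool, l.length = l'.length → (l.map w).prod = (l'.map w).prod → l = l') :
    HasExponentialGrowth G := by
  refine ⟨hG, fun S hfin hS => ?_⟩
  obtain ⟨a, ha⟩ := exists_mem_wordBall hS (w true)
  obtain ⟨b, hb⟩ := exists_mem_wordBall hS (w false)
  set L := a + b + 1 with hL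
  have hwL : ∀ i, w i ∈ wordBall S L := by
    rintro (_ | _)
    exacts [wordBall_mono (by omega) hb, wordBall_mono (by omega) ha]
  have hmono : ∀ {m n : ℕ}, m ≤ n → growthFunction S m ≤ growthFunction S n := fun h =>
    Set.ncard_le_ncard (wordBall_mono h) (wordBall_finite hfin _)
  have hpow : ∀ q : ℕ, 2 ^ q ≤ growthFunction S (q * L) := by
    intro q
    have hmem : ∀ l : List Bool, (l.map w).prod ∈ wordBall S (l.length * L) := by
      intro l
      induction l with
      | nil => simpa using one_mem_wordBall 0
      | cons i l ih =>
        rw [List.map_cons, List.prod_cons, List.length_cons, Nat.succ_mul, add_comm]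
        exact mul_mem_wordBall (hwL i) ih
    have hinj : Function.Injective (fun v : List.Vector Bool q => (v.1.map w).prod) :=
      fun v v' h => Subtype.ext (hw _ _ (v.2.trans v'.2.symm) h)
    have hsub : Set.range (fun v : List.Vector Bool q => (v.1.map w).prod) ⊆
        wordBall S (q * L) := by
      rintro _ ⟨v, rfl⟩
      simpa [v.2] using hmem v.1
    have := Set.ncard_le_ncard hsub (wordBall_finite hfin _)
    rwa [← Nat.card_coe_set_eq, Nat.card_range_of_injective hinj, Nat.card_eq_fintype_card,
      card_vector, Fintype.card_bool] at this
  -- Needed for 0 < n < L, where counting words gives only the bound 1.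
  have hone : 2 ≤ growthFunction S 1 := by
    have hne : ∃ s ∈ S, s ≠ 1 := by
      by_contra! hcon
      have : Subgroup.closure S ≤ ⊥ := (Subgroup.closure_le _).2 fun s hs => by simp [hcon s hs]
      rw [hS] at this
      have h1 : ∀ g : G, g = 1 := fun g => by simpa using this (Subgroup.mem_top g)
      have := hw [true] [false] rfl (by rw [h1 (List.prod _), h1 (List.prod ([false].map w))])
      simp at this
    obtain ⟨s, hs, hs1⟩ := hne
    rw [← Set.ncard_pair hs1]
    refine Set.ncard_le_ncard ?_ (wordBall_finite hfin _)
    rintro x (rfl | rfl)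
    · exact ⟨[x], by simp [hs]⟩
    · exact one_mem_wordBall 1
  have hL0 : (0 : ℝ) < 2 * L := by positivity
  -- The extra factor 2 in the exponent absorbs the rounding: n ≤ 2L⌊n/L⌋ once n ≥ L.
  set c : ℝ := 2 ^ ((1 : ℝ) / (2 * L)) with hc
  have hc1 : 1 < c := Real.one_lt_rpow (by norm_num) (by positivity)
  have hcL : c ^ (2 * L) = 2 := by
    rw [hc, ← Real.rpow_natCast, ← Real.rpow_mul (by norm_num)]
    push_cast
    rw [one_div, inv_mul_cancel₀ hL0.ne', Real.rpow_one]
  refine ⟨c, hc1, fun n => ?_⟩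
  rcases Nat.eq_zero_or_pos n with rfl | hn
  · rw [pow_zero]
    exact_mod_cast (by simpa using hpow 0 : 1 ≤ growthFunction S 0)
  rcases lt_or_ge n L with h | h
  · calc c ^ n ≤ c ^ (2 * L) := pow_le_pow_right₀ hc1.le (by omega)
      _ = 2 := hcL
      _ ≤ growthFunction S n := by exact_mod_cast hone.trans (hmono hn)
  · have hq : 1 ≤ n / L := (Nat.one_le_div_iff (by omega)).2 h
    have hlt : n < (n / L + 1) * L := by
      rw [mul_comm]; exact Nat.lt_mul_div_succ n (by omega)
    calc c ^ n ≤ c ^ (2 * L * (n / L)) := pow_le_pow_right₀ hc1.le (by nlinarith)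
      _ = 2 ^ (n / L) := by rw [pow_mul, hcL]
      _ ≤ growthFunction S n := by
        exact_mod_cast (hpow _).trans (hmono (Nat.div_mul_le_self n L))

end WordBall
open Topology

/-! ### Minimal homeomorphisms, swaps and return maps -/

section Dynamics

variable {X : Type*} [TopologicalSpace X] {φ : X ≃ₜ X}

theorem Homeomorph.zpow_add_apply (φ : X ≃ₜ X) (a b : ℤ) (x : X) :
    (φ ^ (a + b)) x = (φ ^ a) ((φ ^ b) x) := by
  rw [zpow_add, Homeomorph.mul_apply]

theorem Homeomorph.zpow_eq_zpow_of_aperiodic {x : X} (h : ∀ k : ℤ, (φ ^ k) x = x → k = 0) {a b : ℤ}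
    (hab : (φ ^ a) x = (φ ^ b) x) : a = b := by
  have h1 : (φ ^ (-b + a)) x = x := by
    rw [Homeomorph.zpow_add_apply, hab, ← Homeomorph.zpow_add_apply, neg_add_cancel, zpow_zero]
    rfl
  have := h _ h1
  omega

theorem Homeomorph.mul_inv_apply_eq_iff (g : X ≃ₜ X) {x y : X} : g⁻¹ x = y ↔ x = g y :=
  g.toEquiv.symm_apply_eq

/-- Points of a Cantor minimal system are aperiodic. -/
theorem IsCantorMinimalSystem.aperiodic (hφ : IsCantorMinimalSystem X φ) (x : X) (k : ℤ)
    (hk : (φ ^ k) x = x) : k = 0 := by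
  by_contra hk0
  have := hφ.cantor.metrizable
  have := hφ.cantor.perfect
  have : T2Space X := inferInstance
  have hmul : ∀ j : ℤ, (φ ^ (k * j)) x = x := by
    intro j
    have h : ∀ n : ℕ, (φ ^ (k * n)) x = x := by
      intro n
      induction n with
      | zero => simp
      | succ n ih => rw [Nat.cast_succ, mul_add, mul_one, Homeomorph.zpow_add_apply, hk, ih]
    obtain ⟨n, rfl | rfl⟩ := j.eq_nat_or_neg
    · exact h n
    · rw [mul_neg, zpow_neg, Homeomorph.mul_inv_apply_eq_iff, h n]
  -- A finite orbit is closed; being dense it is all of X, which would then be discrete, against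
  -- perfectness.
  have hfin : (Set.range fun n : ℤ => (φ ^ n) x).Finite := by
    refine ((Set.finite_Ico (0 : ℤ) |k|).image fun n => (φ ^ n) x).subset ?_
    rintro _ ⟨n, rfl⟩
    refine ⟨n % k, ⟨Int.emod_nonneg _ hk0, Int.emod_lt_abs _ hk0⟩, ?_⟩
    conv_rhs => rw [← Int.emod_add_mul_ediv n k]
    simp only
    rw [Homeomorph.zpow_add_apply, hmul]
  have huniv : (Set.univ : Set X).Finite := by
    have h := hφ.minimal x
    rw [← h.closure_eq, hfin.isClosed.closure_eq]
    exact hfin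
  have : Finite X := Set.finite_univ_iff.1 huniv
  have h1 : (𝓝[≠] x).NeBot := inferInstance
  have : DiscreteTopology X := inferInstance
  exact h1.ne ((isOpen_singleton_iff_punctured_nhds x).1 (isOpen_discrete {x}))

/-- Every point has uniformly bounded entrance times to a nonempty open set. -/
theorem IsMinimalHomeo.exists_bound [CompactSpace X] (hφ : IsMinimalHomeo φ) {B : Set X}
    (hB : IsOpen B) (hne : B.Nonempty) : ∃ N : ℕ, ∀ x, ∃ k : ℤ, |k| ≤ N ∧ (φ ^ k) x ∈ B := by
  have hcov : (Set.univ : Set X) ⊆ ⋃ k : ℤ, (φ ^ k) ⁻¹' B := by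
    intro x _
    obtain ⟨_, hy, k, rfl⟩ := (hφ x).inter_open_nonempty B hB hne
    exact Set.mem_iUnion.2 ⟨k, hy⟩
  obtain ⟨t, ht⟩ := isCompact_univ.elim_finite_subcover _
    (fun k : ℤ => hB.preimage (φ ^ k).continuous) hcov
  refine ⟨t.sup Int.natAbs, fun x => ?_⟩
  obtain ⟨k, hk, hx⟩ := Set.mem_iUnion₂.1 (ht (Set.mem_univ x))
  refine ⟨k, ?_, hx⟩
  have := Finset.le_sup (f := Int.natAbs) hk
  rw [Int.abs_eq_natAbs]
  exact_mod_cast this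

/-- The uniform bound N turns two-sided recurrence into one-sided: starting from φ^(N+1) x, every
admissible time is still positive for x. -/
theorem IsMinimalHomeo.exists_forward [CompactSpace X] (hφ : IsMinimalHomeo φ) {B : Set X}
    (hB : IsOpen B) (hne : B.Nonempty) (x : X) : ∃ k : ℕ, 0 < k ∧ (φ ^ (k : ℤ)) x ∈ B := by
  obtain ⟨N, hN⟩ := hφ.exists_bound hB hne
  obtain ⟨k, hk, hx⟩ := hN ((φ ^ (N + 1 : ℤ)) x)
  rw [← Homeomorph.zpow_add_apply] at hx
  rw [abs_le] at hk
  refine ⟨(k + (N + 1)).toNat, by omega, ?_⟩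
  rwa [Int.toNat_of_nonneg (by omega)]

theorem IsMinimalHomeo.exists_backward [CompactSpace X] (hφ : IsMinimalHomeo φ) {B : Set X}
    (hB : IsOpen B) (hne : B.Nonempty) (x : X) : ∃ k : ℕ, 0 < k ∧ (φ ^ (-k : ℤ)) x ∈ B := by
  obtain ⟨N, hN⟩ := hφ.exists_bound hB hne
  obtain ⟨k, hk, hx⟩ := hN ((φ ^ (-(N + 1) : ℤ)) x)
  rw [← Homeomorph.zpow_add_apply] at hx
  rw [abs_le] at hk
  refine ⟨(-(k + -(N + 1))).toNat, by omega, ?_⟩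
  rwa [Int.toNat_of_nonneg (by omega), neg_neg]

theorem IsClopen.preimage_homeo {A : Set X} (hA : IsClopen A) (g : X ≃ₜ X) :
    IsClopen {x | g x ∈ A} := hA.preimage g.continuous

/-- A continuous integer-valued cocycle defining a bijection defines an element of the topological
full group. -/
theorem exists_mem_topologicalFullGroup [CompactSpace X] [T2Space X] (c : X → ℤ)
    (hc : Continuous c) (hbij : Function.Bijective fun x => (φ ^ c x) x) :
    ∃ g ∈ topologicalFullGroup φ, ∀ x, g x = (φ ^ c x) x := by
  have hcont : Continuous fun x => (φ ^ c x) x := by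
    rw [continuous_iff_continuousAt]
    intro x
    have hev : (fun y => (φ ^ c y) y) =ᶠ[𝓝 x] fun y => (φ ^ c x) y := by
      have : ∀ᶠ y in 𝓝 x, c y ∈ ({c x} : Set ℤ) :=
        hc.continuousAt.eventually ((isOpen_discrete _).mem_nhds rfl)
      filter_upwards [this] with y hy
      rw [Set.mem_singleton_iff.1 hy]
    exact ((φ ^ c x).continuous.continuousAt).congr hev.symm
  let g : X ≃ₜ X := Continuous.homeoOfEquivCompactToT2 (f := Equiv.ofBijective _ hbij) hcont
  exact ⟨g, ⟨c, hc, fun _ => rfl⟩, fun _ => rfl⟩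

open Classical in
/-- The involution exchanging a clopen set with a disjoint translate lies in the topological full
group. -/
theorem exists_swap_mem_topologicalFullGroup [CompactSpace X] [T2Space X] {E : Set X} (hE : IsClopen E) (k : ℤ)
    (hdisj : ∀ x ∈ E, (φ ^ k) x ∉ E) :
    ∃ g ∈ topologicalFullGroup φ, (∀ x ∈ E, g x = (φ ^ k) x) ∧ (∀ x ∈ E, g ((φ ^ k) x) = x) ∧
      ∀ x, x ∉ E → (φ ^ (-k)) x ∉ E → g x = x := by
  have hinv : ∀ x, (φ ^ (-k)) ((φ ^ k) x) = x := fun x => by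
    rw [← Homeomorph.zpow_add_apply, neg_add_cancel, zpow_zero]; rfl
  have hinv' : ∀ x, (φ ^ k) ((φ ^ (-k)) x) = x := fun x => by
    rw [← Homeomorph.zpow_add_apply, add_neg_cancel, zpow_zero]; rfl
  let c : X → ℤ := fun x => if x ∈ E then k else if (φ ^ (-k)) x ∈ E then -k else 0
  have hc : Continuous c := by
    refine continuous_if ?_ continuous_const.continuousOn (Continuous.continuousOn ?_)
    · intro a ha
      rw [show {x | x ∈ E} = E from rfl, hE.frontier_eq] at ha
      exact ha.elim
    · refine continuous_if ?_ continuous_const.continuousOn continuous_const.continuousOn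
      intro a ha
      rw [(hE.preimage_homeo _).frontier_eq] at ha
      exact ha.elim
  have h1 : ∀ x ∈ E, (φ ^ c x) x = (φ ^ k) x := fun x hx => by simp [c, hx]
  have h2 : ∀ x ∈ E, (φ ^ c ((φ ^ k) x)) ((φ ^ k) x) = x := fun x hx => by
    have : c ((φ ^ k) x) = -k := by simp only [c, if_neg (hdisj x hx), hinv, if_pos hx]
    rw [this, hinv]
  have h3 : ∀ x, x ∉ E → (φ ^ (-k)) x ∉ E → (φ ^ c x) x = x := fun x hx hx' => by
    have : c x = 0 := by simp only [c, if_neg hx, if_neg hx']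
    rw [this, zpow_zero]; rfl
  have hinvol : Function.Involutive fun x => (φ ^ c x) x := by
    intro x
    by_cases hx : x ∈ E
    · simp only [h1 x hx, h2 x hx]
    by_cases hx' : (φ ^ (-k)) x ∈ E
    · have h4 := h2 _ hx'
      rw [hinv'] at h4
      simp only [h4, h1 _ hx', hinv']
    · simp only [h3 x hx hx']
  obtain ⟨g, hg, hgc⟩ := exists_mem_topologicalFullGroup c hc hinvol.bijective
  exact ⟨g, hg, fun x hx => by rw [hgc, h1 x hx], fun x hx => by rw [hgc, h2 x hx],
    fun x hx hx' => by rw [hgc, h3 x hx hx']⟩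

open Classical in
/-- The first return map to a nonempty clopen set, extended by the identity, lies in the
topological full group. -/
theorem exists_return_map [CompactSpace X] [T2Space X] (hφ : IsMinimalHomeo φ) {B : Set X}
    (hB : IsClopen B) (hne : B.Nonempty) :
    ∃ T ∈ topologicalFullGroup φ, ∃ n : X → ℤ, Continuous n ∧ (∀ x, T x = (φ ^ n x) x) ∧
      (∀ x ∈ B, 0 < n x ∧ T x ∈ B) ∧ ∀ x, x ∉ B → T x = x := by
  have hret := hφ.exists_forward hB.isOpen hne
  let r : X → ℕ := fun x => Nat.find (hret x)
  have hr : ∀ x, 0 < r x ∧ (φ ^ (r x : ℤ)) x ∈ B := fun x => Nat.find_spec (hret x)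
  have hrmin : ∀ x (m : ℕ), 0 < m → (φ ^ (m : ℤ)) x ∈ B → r x ≤ m := fun x m h0 h =>
    Nat.find_min' (hret x) ⟨h0, h⟩
  have hreq : ∀ x m, r x = m ↔ (0 < m ∧ (φ ^ (m : ℤ)) x ∈ B) ∧
      ∀ j < m, 0 < j → (φ ^ (j : ℤ)) x ∉ B := by
    intro x m
    rw [Nat.find_eq_iff]
    simp only [not_and]
  have hrcont : Continuous r := by
    refine continuous_discrete_rng.2 fun m => ?_
    have : r ⁻¹' {m} = {x | 0 < m ∧ (φ ^ (m : ℤ)) x ∈ B} ∩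
        ⋂ j ∈ Finset.range m, {x | 0 < j → (φ ^ (j : ℤ)) x ∉ B} := by
      ext x
      simp only [Set.mem_preimage, Set.mem_singleton_iff, hreq x m, Set.mem_inter_iff,
        Set.mem_iInter, Finset.mem_range, Set.mem_ofPred_eq]
    rw [this]
    refine IsOpen.inter ?_ (isOpen_biInter_finset fun j _ => ?_)
    · exact isOpen_const.inter (hB.preimage_homeo _).isOpen
    · by_cases hj : 0 < j
      · simp only [hj, true_imp_iff]
        exact (hB.preimage_homeo _).compl.isOpen
      · simp [hj]
  let n : X → ℤ := fun x => if x ∈ B then (r x : ℤ) else 0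
  have hn : Continuous n := by
    refine continuous_if ?_ (continuous_of_discreteTopology.comp hrcont).continuousOn
      continuous_const.continuousOn
    intro a ha
    rw [show {x | x ∈ B} = B from rfl, hB.frontier_eq] at ha
    exact ha.elim
  have hnB : ∀ x ∈ B, n x = r x := fun x hx => if_pos hx
  have hnB' : ∀ x, x ∉ B → n x = 0 := fun x hx => if_neg hx
  have hTB : ∀ x ∈ B, (φ ^ n x) x ∈ B := fun x hx => by rw [hnB x hx]; exact (hr x).2
  have hTB' : ∀ x, x ∉ B → (φ ^ n x) x = x := fun x hx => by rw [hnB' x hx, zpow_zero]; rfl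
  have hbij : Function.Bijective fun x => (φ ^ n x) x := by
    constructor
    -- If r x < r y, then y would already meet B, at x, at the earlier time r y - r x.
    · have key : ∀ x ∈ B, ∀ y ∈ B, (φ ^ n x) x = (φ ^ n y) y → ¬ r x < r y := by
        intro x hx y hy h hlt
        rw [hnB x hx, hnB y hy] at h
        have h1 : x = (φ ^ ((r y - r x : ℕ) : ℤ)) y := by
          have h2 : (φ ^ (-(r x : ℤ))) ((φ ^ (r x : ℤ)) x) = x := by
            rw [← Homeomorph.zpow_add_apply, neg_add_cancel, zpow_zero]; rfl
          calc x = (φ ^ (-(r x : ℤ))) ((φ ^ (r y : ℤ)) y) := by rw [← h, h2]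
            _ = (φ ^ (-(r x : ℤ) + r y)) y := (Homeomorph.zpow_add_apply _ _ _ _).symm
            _ = _ := by rw [show -(r x : ℤ) + r y = ((r y - r x : ℕ) : ℤ) by omega]
        have := hrmin y (r y - r x) (by omega) (h1 ▸ hx)
        have := (hr x).1
        omega
      intro x y h
      by_cases hx : x ∈ B <;> by_cases hy : y ∈ B
      · have h1 := key x hx y hy h
        have h2 := key y hy x hx h.symm
        have h3 : r x = r y := by omega
        simp only [hnB x hx, hnB y hy, h3] at h
        exact (φ ^ (r y : ℤ)).injective h
      · simp only [hTB' y hy] at h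
        exact absurd (h ▸ hTB x hx) hy
      · simp only [hTB' x hx] at h
        exact absurd (h ▸ hTB y hy) hx
      · simpa only [hTB' x hx, hTB' y hy] using h
    · intro y
      by_cases hy : y ∈ B
      -- The preimage of y is its most recent past visit to B.
      · have hbk := hφ.exists_backward hB.isOpen hne y
        obtain ⟨h0, hmem⟩ := Nat.find_spec hbk
        set m := Nat.find hbk with hm
        have hback : ∀ j : ℕ, (φ ^ (j : ℤ)) ((φ ^ (-m : ℤ)) y) = (φ ^ (j - m : ℤ)) y := fun j => by
          rw [← Homeomorph.zpow_add_apply, sub_eq_add_neg]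
        have hrm : r ((φ ^ (-m : ℤ)) y) = m := by
          rw [hreq]
          refine ⟨⟨h0, ?_⟩, fun j hj hj0 hjB => ?_⟩
          · rw [hback, sub_self, zpow_zero]; exact hy
          · rw [hback] at hjB
            have := Nat.find_min' hbk (m := m - j) ⟨by omega, by
              rwa [show -((m - j : ℕ) : ℤ) = j - m by omega]⟩
            omega
        refine ⟨(φ ^ (-m : ℤ)) y, ?_⟩
        simp only [hnB _ hmem, hrm]
        rw [hback, sub_self, zpow_zero]; rfl
      · exact ⟨y, hTB' y hy⟩
  obtain ⟨T, hT, hTn⟩ := exists_mem_topologicalFullGroup n hn hbij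
  refine ⟨T, hT, n, hn, hTn, fun x hx => ⟨?_, ?_⟩, fun x hx => ?_⟩
  · rw [hnB x hx]; exact_mod_cast (hr x).1
  · rw [hTn]; exact hTB x hx
  · rw [hTn, hTB' x hx]

/-- A point not returning at time `k` has a clopen neighbourhood disjoint from its `k`-th
translate. -/
theorem exists_isClopen_disjoint_translate [CompactSpace X] [T2Space X]
    [TotallyDisconnectedSpace X] {x : X} {k : ℤ} (hk : (φ ^ k) x ≠ x) :
    ∃ U : Set X, IsClopen U ∧ x ∈ U ∧ ∀ z ∈ U, (φ ^ k) z ∉ U := by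
  obtain ⟨V, hV, hxV, hVs⟩ := compact_exists_isClopen_in_isOpen
    (isOpen_compl_singleton (x := (φ ^ k) x)) (show x ∈ _ from hk.symm)
  refine ⟨V ∩ {z | (φ ^ k) z ∈ Vᶜ}, hV.inter (hV.compl.preimage_homeo _), ⟨hxV, fun h => hVs h rfl⟩,
    fun z hz h => hz.2 h.1⟩

end Dynamics
open scoped commutatorElement

/-! ### Finite generation forces a nonperiodic clopen set -/

section CommonPeriod

variable {X : Type*} [TopologicalSpace X] {φ : X ≃ₜ X}

/-- If all clopen subsets of `B` are periodic under `T`, then so is every continuous function with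
discrete values on `B`. -/
theorem exists_common_period [CompactSpace X] (T : X ≃ₜ X) {B : Set X} (hB : IsClopen B)
    (hper : ∀ A ⊆ B, IsClopen A → ∃ m : ℕ, 0 < m ∧ ∀ x ∈ B, (T ^ m) x ∈ A ↔ x ∈ A)
    {α : Type*} [TopologicalSpace α] [DiscreteTopology α] (h : X → α) (hc : Continuous h) :
    ∃ m : ℕ, 0 < m ∧ ∀ x ∈ B, h ((T ^ m) x) = h x := by
  have hfin : (Set.range h).Finite := (isCompact_range hc).finite_of_discrete
  have hA : ∀ v, ∃ m : ℕ, 0 < m ∧ ∀ x ∈ B, (T ^ m) x ∈ B ∩ h ⁻¹' {v} ↔ x ∈ B ∩ h ⁻¹' {v} :=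
    fun v => hper _ Set.inter_subset_left (hB.inter ((isClopen_discrete {v}).preimage hc))
  choose m hm0 hm using hA
  -- By compactness h has finitely many values; the product of the periods of its level sets works
  -- for all.
  refine ⟨∏ v ∈ hfin.toFinset, m v, Finset.prod_pos fun v _ => hm0 v, fun x hx => ?_⟩
  obtain ⟨k, hk⟩ := Finset.dvd_prod_of_mem m (hfin.mem_toFinset.2 ⟨x, rfl⟩ : h x ∈ hfin.toFinset)
  have hmul : ∀ k : ℕ, (T ^ (m (h x) * k)) x ∈ B ∩ h ⁻¹' {h x} := by
    intro k
    induction k with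
    | zero => exact ⟨by simpa using hx, by simp⟩
    | succ k ih =>
      rw [Nat.mul_succ, add_comm, pow_add, Homeomorph.mul_apply]
      exact (hm _ _ ih.1).2 ih
  rw [hk]
  exact (hmul k).2

theorem exists_commutator_coe_eq {G : Type*} [Group G] {H : Subgroup G} {a b : G} (ha : a ∈ H)
    (hb : b ∈ H) : ∃ g : commutator H, ((g : H) : G) = ⁅a, b⁆ :=
  ⟨⟨⁅⟨a, ha⟩, ⟨b, hb⟩⁆, Subgroup.commutator_mem_commutator (Subgroup.mem_top _)
    (Subgroup.mem_top _)⟩, rfl⟩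

/-- The commutator subgroup of the topological full group contains elements moving a given aperiodic
point and fixing a given later point of its orbit. -/
theorem exists_commutator_moving [CompactSpace X] [T2Space X] [TotallyDisconnectedSpace X] {x : X}
    (hx : ∀ k : ℤ, (φ ^ k) x = x → k = 0) {N : ℤ} (hN : 0 < N) :
    ∃ g : commutator (topologicalFullGroup φ), ((g : topologicalFullGroup φ) : X ≃ₜ X) x ≠ x ∧
      ((g : topologicalFullGroup φ) : X ≃ₜ X) ((φ ^ N) x) = (φ ^ N) x := by
  have hadd := Homeomorph.zpow_add_apply φ
  obtain ⟨U₁, hU₁, hxU₁, hd₁⟩ := exists_isClopen_disjoint_translate (φ := φ) (x := x) (k := 1)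
    fun h => by have := hx _ h; omega
  obtain ⟨U₂, hU₂, hxU₂, hd₂⟩ := exists_isClopen_disjoint_translate (φ := φ) (x := x) (k := 2)
    fun h => by have := hx _ h; omega
  -- Below, a swaps U with φ⁻¹U and b swaps φ⁻¹U with φ⁻²U, so their commutator sends x to φ⁻²x.
  -- Keeping U off P puts φᴺx outside both supports.
  let P : Set X := {(φ ^ N) x, (φ ^ (1 + N)) x, (φ ^ (2 + N)) x}
  have hP : P.Finite := by simp [P]
  have hxP : x ∈ Pᶜ := by
    rintro (h | h | h)
    all_goals
      have := hx _ h.symm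
      omega
  obtain ⟨V, hV, hxV, hVP⟩ := compact_exists_isClopen_in_isOpen hP.isClosed.isOpen_compl hxP
  let U := U₁ ∩ U₂ ∩ V
  have hU : IsClopen U := (hU₁.inter hU₂).inter hV
  have hxU : x ∈ U := ⟨⟨hxU₁, hxU₂⟩, hxV⟩
  have h1 : ∀ z ∈ U, (φ ^ (1 : ℤ)) z ∉ U := fun z hz h => hd₁ z hz.1.1 h.1.1
  have h2 : ∀ z ∈ U, (φ ^ (2 : ℤ)) z ∉ U := fun z hz h => hd₂ z hz.1.2 h.1.2
  have hy0 : (φ ^ N) x ∉ U := fun h => hVP h.2 (Or.inl rfl)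
  have hy1 : (φ ^ (1 + N)) x ∉ U := fun h => hVP h.2 (Or.inr (Or.inl rfl))
  have hy2 : (φ ^ (2 + N)) x ∉ U := fun h => hVP h.2 (Or.inr (Or.inr rfl))
  have hneg : ∀ z, (φ ^ (1 : ℤ)) ((φ ^ (-1 : ℤ)) z) = z := fun z => by
    rw [← hadd, add_neg_cancel, zpow_zero]; rfl
  obtain ⟨a, ha, ha1, ha2, ha3⟩ := exists_swap_mem_topologicalFullGroup (φ := φ) hU (-1)
    fun z hz h => h1 _ h (by rwa [hneg])
  obtain ⟨b, hb, hb1, -, hb3⟩ := exists_swap_mem_topologicalFullGroup (φ := φ)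
    (hU.preimage_homeo (φ ^ (1 : ℤ))) (-1)
    fun z hz h => h1 ((φ ^ (1 : ℤ)) ((φ ^ (-1 : ℤ)) z)) h (by rw [hneg]; exact hz)
  rw [neg_neg] at ha3 hb3
  obtain ⟨g, hg⟩ := exists_commutator_coe_eq ha hb
  refine ⟨g, ?_, ?_⟩
  · have e1 : b⁻¹ x = x := by
      rw [Homeomorph.mul_inv_apply_eq_iff, hb3 x (h1 x hxU)]
      intro h
      refine h2 x hxU ?_
      rw [show (2 : ℤ) = 1 + 1 by norm_num, hadd]
      exact h
    have e2 : a⁻¹ x = (φ ^ (-1 : ℤ)) x := by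
      rw [Homeomorph.mul_inv_apply_eq_iff, ha2 x hxU]
    have e3 : b ((φ ^ (-1 : ℤ)) x) = (φ ^ (-2 : ℤ)) x := by
      rw [hb1 _ (show (φ ^ (1 : ℤ)) ((φ ^ (-1 : ℤ)) x) ∈ U by rwa [hneg]), ← hadd]
      norm_num
    have e4 : a ((φ ^ (-2 : ℤ)) x) = (φ ^ (-2 : ℤ)) x := by
      refine ha3 _ (fun h => h2 _ h ?_) (fun h => h1 _ h ?_)
      · rw [← hadd, add_neg_cancel, zpow_zero]; exact hxU
      · rw [← hadd, ← hadd, show (1 : ℤ) + 1 + -2 = 0 by norm_num, zpow_zero]; exact hxU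
    rw [hg, commutatorElement_def, Homeomorph.mul_apply, Homeomorph.mul_apply,
      Homeomorph.mul_apply, e1, e2, e3, e4]
    exact fun h => by have := hx _ h; omega
  · have ea : a ((φ ^ N) x) = (φ ^ N) x := ha3 _ hy0 (by rwa [← hadd])
    have eb : b ((φ ^ N) x) = (φ ^ N) x := by
      refine hb3 _ (fun h => hy1 (by rw [hadd]; exact h)) (fun h => hy2 ?_)
      rw [show 2 + N = 1 + (1 + N) by ring, hadd, hadd]
      exact h
    rw [hg, commutatorElement_def, Homeomorph.mul_apply, Homeomorph.mul_apply,
      Homeomorph.mul_apply, (Homeomorph.mul_inv_apply_eq_iff b).2 eb.symm,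
      (Homeomorph.mul_inv_apply_eq_iff a).2 ea.symm, eb, ea]

/-- If the generators of a group of elements of the topological full group act on the orbits of two
aperiodic points by the same displacements, then so do all its elements. -/
theorem same_displacement_of_closure {x y : X} (hx : ∀ k : ℤ, (φ ^ k) x = x → k = 0)
    {D : Subgroup (topologicalFullGroup φ)} {S : Set D} (hS : Subgroup.closure S = ⊤)
    (hgen : ∀ s ∈ S, ∀ j : ℤ, ∃ k : ℤ, (s : topologicalFullGroup φ).1 ((φ ^ j) x) = (φ ^ k) x ∧
      (s : topologicalFullGroup φ).1 ((φ ^ j) y) = (φ ^ k) y) (g : D) :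
    ∀ j : ℤ, ∃ k : ℤ, (g : topologicalFullGroup φ).1 ((φ ^ j) x) = (φ ^ k) x ∧
      (g : topologicalFullGroup φ).1 ((φ ^ j) y) = (φ ^ k) y := by
  have hg : g ∈ Subgroup.closure S := hS ▸ Subgroup.mem_top g
  induction hg using Subgroup.closure_induction with
  | mem s hs => exact hgen s hs
  | one => exact fun j => ⟨j, rfl, rfl⟩
  | mul a b _ _ ha hb =>
    intro j
    obtain ⟨k, hk, hk'⟩ := hb j
    obtain ⟨l, hl, hl'⟩ := ha k
    refine ⟨l, ?_, ?_⟩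
    · rw [← hl, ← hk]; rfl
    · rw [← hl', ← hk']; rfl
  | inv a _ ha =>
    intro j
    obtain ⟨c, -, hc⟩ := (a⁻¹ : D).1.2
    -- The cocycle of the inverse locates the preimage along the orbit of x; aperiodicity of x shows
    -- that a takes index k to j, and this transfers to y.
    have hk : (a : topologicalFullGroup φ).1⁻¹ ((φ ^ j) x) =
        (φ ^ (c ((φ ^ j) x) + j)) x := by
      rw [Homeomorph.zpow_add_apply]; exact hc _
    set k := c ((φ ^ j) x) + j
    obtain ⟨l, hl, hl'⟩ := ha k
    have hjl : j = l := Homeomorph.zpow_eq_zpow_of_aperiodic hx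
      (((Homeomorph.mul_inv_apply_eq_iff _).1 hk).trans hl)
    refine ⟨k, hk, (Homeomorph.mul_inv_apply_eq_iff _).2 ?_⟩
    rw [hl', hjl]

/-- If the commutator subgroup of the topological full group is finitely generated, then for a
first return map some clopen set is not periodic. -/
theorem exists_nonperiodic_of_fg [CompactSpace X] [T2Space X] [TotallyDisconnectedSpace X]
    (hap : ∀ (x : X) (k : ℤ), (φ ^ k) x = x → k = 0)
    (hfg : Group.FG (commutator (topologicalFullGroup φ))) {B : Set X} (hB : IsClopen B)
    (hne : B.Nonempty) {T : X ≃ₜ X} {n : X → ℤ} (hn : Continuous n)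
    (hTn : ∀ x, T x = (φ ^ n x) x) (hTB : ∀ x ∈ B, 0 < n x ∧ T x ∈ B)
    (hTB' : ∀ x, x ∉ B → T x = x) :
    ∃ A ⊆ B, IsClopen A ∧ ∀ m : ℕ, 0 < m → ∃ x ∈ B, ¬ ((T ^ m) x ∈ A ↔ x ∈ A) := by
  by_contra! hcon
  obtain ⟨S, hS⟩ := Group.fg_def.1 hfg
  have hcoc : ∀ s : S, ∃ c : X → ℤ, Continuous c ∧
      ∀ x, (s.1 : topologicalFullGroup φ).1 x = (φ ^ c x) x := fun s => s.1.1.2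
  choose c hc hsc using hcoc
  obtain ⟨N, hN⟩ := (isCompact_range hn).bddAbove
  -- Records the return time and the cocycles of all generators at times 0, …, N - 1. As N bounds
  -- the return times, this covers the whole stretch of orbit before the next return.
  let h : X → ℤ × (S → Fin N.toNat → ℤ) :=
    fun x => (n x, fun s j => c s ((φ ^ (j : ℤ)) x))
  have hh : Continuous h := hn.prodMk (continuous_pi fun s => continuous_pi fun j =>
    (hc s).comp (φ ^ (j : ℤ)).continuous)
  obtain ⟨m, hm0, hm⟩ := exists_common_period T hB hcon h hh
  have hmn : ∀ z ∈ B, n ((T ^ m) z) = n z := fun z hz => congrArg Prod.fst (hm z hz)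
  have hcomm : ∀ z, T ((T ^ m) z) = (T ^ m) (T z) := fun z => by
    rw [← Homeomorph.mul_apply, ← Homeomorph.mul_apply, ← pow_succ, ← pow_succ']
  have hstep : ∀ z ∈ B, ∀ j : ℤ, (φ ^ j) z = (φ ^ (j - n z)) (T z) ∧
      (φ ^ j) ((T ^ m) z) = (φ ^ (j - n z)) ((T ^ m) (T z)) := by
    intro z hz j
    rw [← hcomm, hTn z, hTn ((T ^ m) z), hmn z hz, ← Homeomorph.zpow_add_apply,
      ← Homeomorph.zpow_add_apply, sub_add_cancel]
    exact ⟨rfl, rfl⟩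
  -- For j ≥ N, pass from z to T z: this lowers j by n z > 0, the same amount for z and Tᵐz.
  have hnonneg : ∀ (s : S) (j : ℕ), ∀ z ∈ B,
      c s ((φ ^ (j : ℤ)) ((T ^ m) z)) = c s ((φ ^ (j : ℤ)) z) := by
    intro s j
    induction j using Nat.strong_induction_on with
    | _ j ih =>
      intro z hz
      by_cases hj : j < N.toNat
      · exact congrFun (congrFun (congrArg Prod.snd (hm z hz)) s) ⟨j, hj⟩
      · have h1 : n z ≤ N := hN ⟨z, rfl⟩
        have h2 := (hTB z hz).1
        have h3 := ih (j - (n z).toNat) (by omega) (T z) (hTB z hz).2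
        rw [(hstep z hz j).1, (hstep z hz j).2]
        rwa [show ((j - (n z).toNat : ℕ) : ℤ) = j - n z by omega] at h3
  have hpre : ∀ z ∈ B, ∃ u ∈ B, T u = z := by
    intro z hz
    obtain ⟨u, rfl⟩ := T.surjective z
    refine ⟨u, ?_, rfl⟩
    by_contra hu
    exact hu (hTB' u hu ▸ hz)
  -- Negative times are raised by stepping back to the T-preimage of z in B.
  have hall : ∀ (s : S) (k : ℕ) (j : ℤ), -k ≤ j → ∀ z ∈ B,
      c s ((φ ^ j) ((T ^ m) z)) = c s ((φ ^ j) z) := by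
    intro s k
    induction k with
    | zero =>
      intro j hj z hz
      lift j to ℕ using by simpa using hj
      exact hnonneg s j z hz
    | succ k ih =>
      intro j hj z hz
      obtain ⟨u, hu, rfl⟩ := hpre z hz
      have h1 := hstep u hu (j + n u)
      rw [add_sub_cancel_right] at h1
      rw [← h1.1, ← h1.2]
      have := (hTB u hu).1
      exact ih _ (by push_cast at hj; omega) u hu
  obtain ⟨x, hx⟩ := hne
  have hpos : ∀ k : ℕ, (T ^ k) x ∈ B ∧ ∃ M : ℤ, (k : ℤ) ≤ M ∧ (T ^ k) x = (φ ^ M) x := by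
    intro k
    induction k with
    | zero => exact ⟨hx, 0, le_rfl, rfl⟩
    | succ k ih =>
      obtain ⟨h1, M, hM, h2⟩ := ih
      rw [pow_succ', Homeomorph.mul_apply]
      refine ⟨(hTB _ h1).2, n ((T ^ k) x) + M, ?_, ?_⟩
      · have := (hTB _ h1).1
        push_cast
        omega
      · rw [hTn, Homeomorph.zpow_add_apply, ← h2]
  obtain ⟨-, M, hM, hTM⟩ := hpos m
  obtain ⟨g, hgx, hgy⟩ := exists_commutator_moving (hap x) (N := M) (by omega)
  have hsame := same_displacement_of_closure (hap x) (y := (T ^ m) x) hS (fun s hs j => by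
    refine ⟨c ⟨s, hs⟩ ((φ ^ j) x) + j, ?_, ?_⟩
    · rw [Homeomorph.zpow_add_apply]; exact hsc ⟨s, hs⟩ _
    · rw [Homeomorph.zpow_add_apply, ← hall ⟨s, hs⟩ j.natAbs j (by omega) x hx]
      exact hsc ⟨s, hs⟩ _) g 0
  obtain ⟨k, hkx, hky⟩ := hsame
  have hk : k = 0 := by
    refine hap ((T ^ m) x) k (hky.symm.trans ?_)
    rw [hTM]
    exact hgy
  rw [hk] at hkx
  exact hgx hkx

end CommonPeriod

/-! ### Free words from a lamplighter action -/

section Words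

variable {X : Type*} [TopologicalSpace X] {φ : X ≃ₜ X}

open Polynomial in
/-- Lamplighter action of positive words: `t` shifts the base point, `s` adds a function of the
base point to the fibre coordinate. -/
theorem prod_words_apply {Y : Type*} {s t : X ≃ₜ X} (T : Equiv.Perm Y) {i : ZMod 2 → Y → X}
    {f : Y → ZMod 2} (ht : ∀ j y, t (i j y) = i j (T y)) (hs : ∀ j y, s (i j y) = i (j + f y) y)
    (l : List Bool) : ∀ j y, (l.map fun b => if b then t * s else t).prod (i j y) =
      i (j + (aeval (LinearMap.funLeft (ZMod 2) (ZMod 2) T) (bitPolynomial l)) f y)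
        ((T ^ l.length) y) := by
  have hpow : ∀ k : ℕ, ∀ y, ((LinearMap.funLeft (ZMod 2) (ZMod 2) T) ^ k) f y = f ((T ^ k) y) := by
    intro k
    induction k with
    | zero => simp
    | succ k ih => intro y; rw [pow_succ', Module.End.mul_apply, LinearMap.funLeft_apply, ih,
        pow_succ, Equiv.Perm.mul_apply]
  induction l with
  | nil => intro j y; simp [bitPolynomial]
  -- The head of the list acts last, after `l.length` shifts, so it is the leading coefficient.
  | cons b l ih =>
    intro j y
    rw [List.map_cons, List.prod_cons, Homeomorph.mul_apply, ih, List.length_cons, pow_succ',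
      Equiv.Perm.mul_apply, bitPolynomial, map_add, LinearMap.add_apply, Pi.add_apply]
    cases b
    · simp [ht]
    · simp only [if_true, Homeomorph.mul_apply, hs, ht, map_pow, aeval_X, hpow]
      congr 1
      ring

/-- The two elements of the commutator subgroup generating a free semigroup. -/
theorem exists_free_words [CompactSpace X] [T2Space X] {B A : Set X} (hB : IsClopen B)
    (hdisj : ∀ x ∈ B, ∀ k : ℤ, 0 < k → k ≤ 3 → (φ ^ k) x ∉ B) {T : X ≃ₜ X}
    (hT : T ∈ topologicalFullGroup φ) (hTB : ∀ x ∈ B, T x ∈ B) (hTB' : ∀ x, x ∉ B → T x = x)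
    (hAB : A ⊆ B) (hA : IsClopen A)
    (hnp : ∀ m : ℕ, 0 < m → ∃ x ∈ B, ¬ ((T ^ m) x ∈ A ↔ x ∈ A)) :
    ∃ w : Bool → commutator (topologicalFullGroup φ), ∀ l l' : List Bool, l.length = l'.length →
      (l.map w).prod = (l'.map w).prod → l = l' := by
  classical
  have hφmem : φ ∈ topologicalFullGroup φ := ⟨fun _ => 1, continuous_const, fun x => by simp⟩
  have hadd := Homeomorph.zpow_add_apply φ
  have hneg : ∀ (k : ℤ) z, (φ ^ (-k)) ((φ ^ k) z) = z := fun k z => by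
    rw [← hadd, neg_add_cancel, zpow_zero]; rfl
  have hback : ∀ (k l : ℤ), ∀ x ∈ B, k ≠ l → k - l ≤ 3 → l - k ≤ 3 →
      (φ ^ (k - l)) x ∉ B := by
    intro k l x hx hkl h1 h2 h
    rcases lt_or_gt_of_ne hkl with hlt | hlt
    · refine hdisj _ h (l - k) (by omega) h2 ?_
      rw [← hadd, show l - k + (k - l) = 0 by ring, zpow_zero]
      exact hx
    · exact hdisj x hx (k - l) (by omega) h1 h
  obtain ⟨a, ha, ha1, ha2, ha3⟩ := exists_swap_mem_topologicalFullGroup (φ := φ) hA 1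
    fun x hx h => hdisj x (hAB hx) 1 one_pos (by norm_num) (hAB h)
  -- w exchanges B ∪ φB with φ²B ∪ φ³B, where T · φTφ⁻¹ is trivial. The commutator of T · φTφ⁻¹ with
  -- w therefore lies in D and agrees with T · φTφ⁻¹ on B ∪ φB.
  obtain ⟨w, hw, -, hw2, -⟩ := exists_swap_mem_topologicalFullGroup (φ := φ)
    (E := B ∪ {x | (φ ^ (-1 : ℤ)) x ∈ B}) (hB.union (hB.preimage_homeo _)) 2 (by
      rintro x (hx | hx) (h | h)
      · exact hback 2 0 x hx (by norm_num) (by norm_num) (by norm_num) h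
      · refine hback 1 0 x hx (by norm_num) (by norm_num) (by norm_num) ?_
        have h' : (φ ^ (-1 : ℤ)) ((φ ^ (2 : ℤ)) x) ∈ B := h
        rwa [← hadd] at h'
      · refine hback 3 0 _ hx (by norm_num) (by norm_num) (by norm_num) ?_
        rwa [← hadd]
      · refine hback 2 0 _ hx (by norm_num) (by norm_num) (by norm_num) ?_
        have h' : (φ ^ (-1 : ℤ)) ((φ ^ (2 : ℤ)) x) ∈ B := h
        rw [← hadd] at h' ⊢
        exact h')
  have hw0 : ∀ x ∈ B, w⁻¹ x = (φ ^ (2 : ℤ)) x ∧ w ((φ ^ (2 : ℤ)) x) = x := fun x hx =>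
    have := hw2 x (Or.inl hx)
    ⟨(Homeomorph.mul_inv_apply_eq_iff w).2 this.symm, this⟩
  have hw1 : ∀ x ∈ B, w⁻¹ (φ x) = (φ ^ (3 : ℤ)) x ∧ w ((φ ^ (3 : ℤ)) x) = φ x := fun x hx => by
    have h1 := hw2 (φ x) (Or.inr (by
      have := hneg 1 x
      rw [zpow_one] at this
      show (φ ^ (-1 : ℤ)) (φ x) ∈ B
      rwa [this]))
    have h2 : (φ ^ (2 : ℤ)) (φ x) = (φ ^ (3 : ℤ)) x := by
      rw [show (3 : ℤ) = 2 + 1 by norm_num, hadd, zpow_one]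
    rw [h2] at h1
    exact ⟨(Homeomorph.mul_inv_apply_eq_iff w).2 h1.symm, h1⟩
  have ht₀ : T * (φ * T * φ⁻¹) ∈ topologicalFullGroup φ :=
    mul_mem hT (mul_mem (mul_mem hφmem hT) (inv_mem hφmem))
  have ht₀app : ∀ x, (T * (φ * T * φ⁻¹)) x = T (φ (T (φ⁻¹ x))) := fun x => rfl
  have hinv1 : ∀ x, φ⁻¹ (φ x) = x := fun x => (Homeomorph.mul_inv_apply_eq_iff φ).2 rfl
  have hinv2 : ∀ x, φ (φ⁻¹ x) = x := fun x => ((Homeomorph.mul_inv_apply_eq_iff φ).1 rfl).symm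
  have hφB : ∀ x ∈ B, φ x ∉ B := fun x hx => by
    have := hdisj x hx 1 one_pos (by norm_num)
    rwa [zpow_one] at this
  have hφB' : ∀ x ∈ B, φ⁻¹ x ∉ B := fun x hx h => hφB _ h (by rwa [hinv2])
  have ht₀B : ∀ x ∈ B, (T * (φ * T * φ⁻¹)) x = T x := fun x hx => by
    rw [ht₀app, hTB' _ (hφB' x hx), hinv2]
  have ht₀φB : ∀ x ∈ B, (T * (φ * T * φ⁻¹)) (φ x) = φ (T x) := fun x hx => by
    rw [ht₀app, hinv1, hTB' _ (hφB _ (hTB x hx))]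
  have ht₀fix : ∀ x, x ∉ B → φ⁻¹ x ∉ B → (T * (φ * T * φ⁻¹))⁻¹ x = x := fun x hx hx' => by
    rw [Homeomorph.mul_inv_apply_eq_iff, ht₀app, hTB' _ hx', hinv2, hTB' x hx]
  have hφinv : ∀ (k : ℤ) x, φ⁻¹ ((φ ^ k) x) = (φ ^ (k - 1)) x := fun k x => by
    rw [sub_eq_neg_add, hadd, zpow_neg_one]
  obtain ⟨t, ht⟩ := exists_commutator_coe_eq ht₀ hw
  have htB : ∀ x ∈ B, t.1.1 x = T x := fun x hx => by
    rw [ht, commutatorElement_def, Homeomorph.mul_apply, Homeomorph.mul_apply,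
      Homeomorph.mul_apply, (hw0 x hx).1, ht₀fix _ (hdisj x hx 2 (by norm_num) (by norm_num))
        (by rw [hφinv]; exact hdisj x hx _ (by norm_num) (by norm_num)), (hw0 x hx).2, ht₀B x hx]
  have htφB : ∀ x ∈ B, t.1.1 (φ x) = φ (T x) := fun x hx => by
    rw [ht, commutatorElement_def, Homeomorph.mul_apply, Homeomorph.mul_apply,
      Homeomorph.mul_apply, (hw1 x hx).1, ht₀fix _ (hdisj x hx 3 (by norm_num) (by norm_num))
        (by rw [hφinv]; exact hdisj x hx _ (by norm_num) (by norm_num)), (hw1 x hx).2, ht₀φB x hx]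
  obtain ⟨s, hs⟩ := exists_commutator_coe_eq (inv_mem t.1.2) ha
  have hTiff : ∀ x, T x ∈ B ↔ x ∈ B := fun x =>
    ⟨fun h => by_contra fun hx => hx (hTB' x hx ▸ h), hTB x⟩
  let τ : Equiv.Perm B := Equiv.Perm.subtypePerm T.toEquiv hTiff
  have hτ : ∀ (m : ℕ) (y : B), ((τ ^ m) y : X) = (T ^ m) y := by
    intro m
    induction m with
    | zero => exact fun y => rfl
    | succ m ih =>
      intro y
      rw [pow_succ', pow_succ', Equiv.Perm.mul_apply, Homeomorph.mul_apply, ← ih]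
      rfl
  -- Identifies ℤ/2 × B with B ⊔ φB.
  let i : ZMod 2 → B → X := fun j y => if j = 0 then y else φ y
  let f : B → ZMod 2 := fun y => if (y : X) ∈ A then 1 else 0
  have hi_inj : ∀ j j' y, i j y = i j' y → j = j' := by
    intro j j' y h
    have hne : (y : X) ≠ φ y := fun h' => hφB y y.2 (h' ▸ y.2)
    have h01 : ∀ k : ZMod 2, k ≠ 0 → k = 1 := by decide
    by_cases hj : j = 0 <;> by_cases hj' : j' = 0
    · rw [hj, hj']
    · simp only [i, if_pos hj, if_neg hj'] at h
      exact absurd h hne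
    · simp only [i, if_pos hj', if_neg hj] at h
      exact absurd h.symm hne
    · rw [h01 j hj, h01 j' hj']
  have hit : ∀ j y, t.1.1 (i j y) = i j (τ y) := by
    intro j y
    by_cases hj : j = 0
    · simp only [i, if_pos hj]; exact htB y y.2
    · simp only [i, if_neg hj]; exact htφB y y.2
  have hia : ∀ j y, a (i j y) = i (j + f y) y := by
    intro j y
    have h01 : ∀ k : ZMod 2, k ≠ 0 → k = 1 := by decide
    by_cases hy : (y : X) ∈ A
    · have hf : f y = 1 := if_pos hy
      rw [hf]
      by_cases hj : j = 0
      · have : a y = φ y := by rw [ha1 _ hy, zpow_one]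
        simpa [i, hj] using this
      · have h2 : a (φ y) = y := by simpa using ha2 _ hy
        rw [h01 j hj]
        have h11 : (1 : ZMod 2) + 1 = 0 := by decide
        simpa [i, h11] using h2
    · have hf : f y = 0 := if_neg hy
      rw [hf, add_zero]
      by_cases hj : j = 0
      · simp only [i, if_pos hj]
        exact ha3 _ hy fun h => hφB' y y.2 (hAB h)
      · simp only [i, if_neg hj]
        refine ha3 _ (fun h => hφB y y.2 (hAB h)) fun h => hy ?_
        rwa [zpow_neg_one, hinv1] at h
  have his : ∀ j y, s.1.1 (i j y) = i (j + (f y + f (τ y))) y := by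
    intro j y
    have h2 : ∀ k l : ZMod 2, k + l + l = k := by decide
    have e1 : a⁻¹ (i j y) = i (j + f y) y := by
      rw [Homeomorph.mul_inv_apply_eq_iff, hia, h2]
    have e2 : (t.1.1)⁻¹ (i (j + f y + f (τ y)) (τ y)) = i (j + f y + f (τ y)) y := by
      rw [Homeomorph.mul_inv_apply_eq_iff, hit]
    rw [hs, commutatorElement_def, Homeomorph.mul_apply, Homeomorph.mul_apply,
      Homeomorph.mul_apply, e1, inv_inv, hit, hia, e2, add_assoc]
  refine ⟨fun b => if b then t * s else t, fun l l' hl h => ?_⟩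
  by_contra hne
  let ρ := (topologicalFullGroup φ).subtype.comp (commutator (topologicalFullGroup φ)).subtype
  have hρ : ∀ l : List Bool, ρ (l.map fun b => if b then t * s else t).prod =
      (l.map fun b => if b then t.1.1 * s.1.1 else t.1.1).prod := by
    intro l
    rw [map_list_prod, List.map_map]
    congr 2
    funext b
    cases b <;> rfl
  have hprod := congrArg ρ h
  rw [hρ, hρ] at hprod
  let Φ := LinearMap.funLeft (ZMod 2) (ZMod 2) τ
  let f' : B → ZMod 2 := fun y => f y + f (τ y)
  have hker : (Polynomial.aeval Φ (bitPolynomial l - bitPolynomial l')) f' = 0 := by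
    funext y
    have h1 := congrArg (fun g : X ≃ₜ X => g (i 0 y)) hprod
    simp only [prod_words_apply τ hit his, hl, zero_add] at h1
    rw [map_sub, LinearMap.sub_apply, Pi.sub_apply, Pi.zero_apply, sub_eq_zero]
    exact hi_inj _ _ _ h1
  have hf' : f' = Polynomial.aeval Φ (1 + Polynomial.X : Polynomial (ZMod 2)) f := by
    rw [map_add, map_one, Polynomial.aeval_X]
    rfl
  -- The factor 1 + X, the price of replacing a by a commutator, is harmless because 𝔽₂[X] is a
  -- domain.
  have hp : (bitPolynomial l - bitPolynomial l') * (1 + Polynomial.X) ≠ 0 := by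
    refine mul_ne_zero (fun h0 => hne (bitPolynomial_injective_of_length_eq l l' hl
      (sub_eq_zero.1 h0))) fun h0 => ?_
    have := congrArg (fun p => Polynomial.coeff p 1) h0
    simp [Polynomial.coeff_one] at this
  obtain ⟨m, hm0, hm⟩ := exists_period_of_aeval_eq_zero τ f hp (by
    rw [map_mul, Module.End.mul_apply, ← hf']; exact hker)
  obtain ⟨x, hx, hxA⟩ := hnp m hm0
  refine hxA ?_
  have h1 := hm ⟨x, hx⟩
  simp only [f, hτ] at h1
  by_cases h2 : (T ^ m) x ∈ A <;> by_cases h3 : x ∈ A <;> simp_all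

end Words

theorem corollary2p5 {X : Type*} [TopologicalSpace X] (φ : X ≃ₜ X)
    (hφ : IsCantorMinimalSystem X φ)
    (hfg : Group.FG ↥(commutator ↥(topologicalFullGroup φ))) :
    HasExponentialGrowth ↥(commutator ↥(topologicalFullGroup φ)) := by
  have := hφ.cantor.compact
  have := hφ.cantor.metrizable
  have := hφ.cantor.totallyDisconnected
  obtain ⟨x⟩ := hφ.cantor.nonempty
  have hU : ∀ k : ℤ, k ≠ 0 → ∃ U : Set X, IsClopen U ∧ x ∈ U ∧ ∀ z ∈ U, (φ ^ k) z ∉ U :=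
    fun k hk => exists_isClopen_disjoint_translate fun h => hk (hφ.aperiodic x k h)
  obtain ⟨U₁, hU₁, hx₁, hd₁⟩ := hU 1 (by norm_num)
  obtain ⟨U₂, hU₂, hx₂, hd₂⟩ := hU 2 (by norm_num)
  obtain ⟨U₃, hU₃, hx₃, hd₃⟩ := hU 3 (by norm_num)
  have hB : IsClopen (U₁ ∩ U₂ ∩ U₃) := (hU₁.inter hU₂).inter hU₃
  have hne : (U₁ ∩ U₂ ∩ U₃).Nonempty := ⟨x, ⟨hx₁, hx₂⟩, hx₃⟩
  obtain ⟨T, hT, n, hn, hTn, hTB, hTB'⟩ := exists_return_map hφ.minimal hB hne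
  obtain ⟨A, hAB, hA, hnp⟩ :=
    exists_nonperiodic_of_fg hφ.aperiodic hfg hB hne hn hTn hTB hTB'
  obtain ⟨w, hw⟩ := exists_free_words hB (fun z hz k hk0 hk3 h => by
    obtain rfl | rfl | rfl : k = 1 ∨ k = 2 ∨ k = 3 := by omega
    exacts [hd₁ z hz.1.1 h.1.1, hd₂ z hz.1.2 h.1.2, hd₃ z hz.2 h.2])
    hT (fun z hz => (hTB z hz).2) hTB' hAB hA hnp
  exact hasExponentialGrowth_of_words hfg w hw
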